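/- Throughout, a graph is a finite loopless multigraph (parallel edges allowed). Let $G$ and $H$ be connected graphs. Write $\kappa(G)$ for the vertex-connectivity of $G$ (the smallest number of vertices in a proper subset of $V(G)$ whose removal leaves a graph with at least two components or a single vertex), and $\lambda(G)$ for the edge-connectivity (the smallest number of edges, counted with multiplicity, whose removal leaves a disconnected graph or a graph on a single vertex). Write $G\square H$ for the Cartesian product: it has vertex set $V(G)\times V(H)$, and $(u_1,v_1)\ne(u_2,v_2)$ are joined by $e$ edges if $u_1=u_2$ and $v_1,v_2$ are joined by $e$ edges in $H$, or $v_1=v_2$ and $u_1,u_2$ are joined by $e$ edges in $G$; otherwise they are not joined. A scramble on $G$ is a collection $\mathcal S$ of nonempty connected subsets of $V(G)$ (eggs). Its order is the largest integer $m$ such that every set of vertices meeting all eggs has at least $m$ elements, and $|E(A,A^c)|\ge m$ for every $A\subset V(G)$ such that some egg is contained in $A$ and some egg is contained in $A^c$. The scramble number $\mathrm{sn}(G)$ is the largest order of a scramble on $G$. A divisor on $G$ is an element $D=\sum_{v}a_v(v)$ of the free abelian group on $V(G)$; its degree is $\sum_v a_v$, and it is effective if all $a_v\ge 0$. Chip-firing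 a vertex $w$ removes from $w$ as many chips as there are edges incident to $w$ and adds to every other vertex $v$ as many chips as there are edges joining $v$ and $w$. Divisors are equivalent if one is obtained from the other by a sequence of chip-firing moves. The rank of $D$ is $-1$ if $D$ is not equivalent to an effective divisor, and otherwise the largest integer $r\ge 0$ such that $D-E$ is equivalent to an effective divisor for every effective divisor $E$ of degree $r$. The gonality $\mathrm{gon}(G)$ is the smallest degree of a divisor of positive rank on $G$. **Theorem.** Let $G$ and $H$ be connected graphs and let $k\ge 0$ be an integer with $k\le\kappa(G)$, $|V(G)|\ge 2k-1$ and $\lambda(G)\ge (k-1)\lambda(H)$. (i) If $k|V(H)|\le |V(G)|\lambda(H)$ and $\mathrm{gon}(G)=k$, then $\mathrm{sn}(G\square H)=\mathrm{gon}(G\square H)=k|V(H)|$. (ii) If $|V(G)|\lambda(H)\le k|V(H)|$ and $\mathrm{gon}(H)=\lambda(H)$, then $\mathrm{sn}(G\square H)=\mathrm{gon}(G\square H)=|V(G)|\lambda(H)$. -/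

import Mathlib

/-- A loopless multigraph with vertex type `V`. Its edge multiset is recorded by the multiplicity of
each unordered pair of vertices. -/
structure Multigraph (V : Type*) where
  mult : Sym2 V → ℕ
  loopless : ∀ v : V, mult s(v, v) = 0

namespace Multigraph

section Basic

variable {V : Type*} (G : Multigraph V)

/-- The simple graph in which two vertices are adjacent if at least one edge joins them. -/
def toSimpleGraph : SimpleGraph V where
  Adj u v := 0 < G.mult s(u, v)
  symm := ⟨fun u v h => by rwa [Sym2.eq_swap]⟩
  loopless := ⟨fun v h => by simp [G.loopless v] at h⟩

/-- A (nonempty) multigraph is connected if any two of its vertices are joined by a path. -/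
def Connected : Prop := G.toSimpleGraph.Connected

/-- A vertex set is connected if it is nonempty and the subgraph it induces is connected. -/
def ConnectedSubset (A : Finset V) : Prop := (G.toSimpleGraph.induce (A : Set V)).Connected

/-- Removal of the edge multiset with multiplicities `D`. -/
def deleteEdges (D : Sym2 V → ℕ) : Multigraph V where
  mult e := G.mult e - D e
  loopless v := by simp [G.loopless v]

/-- The number `|E(A, B)|` of edges with one end in `A` and the other in `B`, for disjoint `A`, `B`. -/
def edgesBetween (A B : Finset V) : ℕ := ∑ a ∈ A, ∑ b ∈ B, G.mult s(a, b)

/-- The Cartesian product of two multigraphs. -/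
def boxProd {W : Type*} [DecidableEq V] [DecidableEq W] (G : Multigraph V) (H : Multigraph W) :
    Multigraph (V × W) where
  mult := Sym2.lift
    ⟨fun p q => (if p.1 = q.1 then H.mult s(p.2, q.2) else 0) +
        (if p.2 = q.2 then G.mult s(p.1, q.1) else 0),
      fun p q => by
        simp only [eq_comm (a := p.1), eq_comm (a := p.2), Sym2.eq_swap (a := p.1),
          Sym2.eq_swap (a := p.2)]⟩
  loopless p := by simp [G.loopless, H.loopless]

end Basic

section Invariants

variable {V : Type*} [Fintype V] [DecidableEq V] (G : Multigraph V)

/-- A vertex cut: a proper subset `S` of the vertices whose removal leaves a graph that has at least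
two components or a single vertex. -/
def IsVertexCut (S : Finset V) : Prop :=
  S ≠ Finset.univ ∧
    (¬ (G.toSimpleGraph.induce ((Sᶜ : Finset V) : Set V)).Preconnected ∨ Sᶜ.card = 1)

/-- The vertex-connectivity `κ(G)`. -/
noncomputable def vertexConnectivity : ℕ := sInf {n | ∃ S, G.IsVertexCut S ∧ S.card = n}

/-- An edge cut: a sub-multiset `D` of the edges whose removal leaves a graph that is disconnected or
has a single vertex. -/
def IsEdgeCut (D : Sym2 V → ℕ) : Prop :=
  D ≤ G.mult ∧ (¬ (G.deleteEdges D).toSimpleGraph.Preconnected ∨ Fintype.card V = 1)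

/-- The edge-connectivity `λ(G)`. -/
noncomputable def edgeConnectivity : ℕ := sInf {n | ∃ D, G.IsEdgeCut D ∧ ∑ e, D e = n}

/-! ### Scrambles -/

/-- A scramble: a collection of connected nonempty vertex sets (the eggs). -/
def IsScramble (S : Finset (Finset V)) : Prop := ∀ E ∈ S, G.ConnectedSubset E

/-- `C` covers `S` if it meets every egg. -/
def IsHittingSet (S : Finset (Finset V)) (C : Finset V) : Prop := ∀ E ∈ S, (C ∩ E).Nonempty

/-- An egg-cut of `S`: a vertex set such that some egg lies inside it and some egg lies outside. -/
def IsEggCut (S : Finset (Finset V)) (A : Finset V) : Prop :=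
  ∃ E₁ ∈ S, ∃ E₂ ∈ S, E₁ ⊆ A ∧ E₂ ⊆ Aᶜ

/-- The order of a scramble: the largest `k` such that no set with fewer than `k` elements covers the
scramble and every egg-cut has size at least `k`. -/
noncomputable def scrambleOrder (S : Finset (Finset V)) : ℕ :=
  sSup {k | (∀ C, IsHittingSet S C → k ≤ C.card) ∧
    ∀ A, IsEggCut S A → k ≤ G.edgesBetween A Aᶜ}

/-- The scramble number `sn(G)`: the largest order of a scramble. -/
noncomputable def scrambleNumber : ℕ := sSup {n | ∃ S, G.IsScramble S ∧ G.scrambleOrder S = n}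

/-! ### Divisors and gonality -/

/-- The number of edges incident to `v`. -/
def valence (v : V) : ℕ := ∑ u, G.mult s(v, u)

/-- The divisor obtained from `D` by chip-firing `w`. -/
def chipFire (w : V) (D : V → ℤ) : V → ℤ := fun v =>
  if v = w then D v - G.valence w else D v + G.mult s(v, w)

/-- `D₂` can be obtained from `D₁` by a finite sequence of chip-firing moves. -/
def DivisorEquiv (D₁ D₂ : V → ℤ) : Prop :=
  Relation.ReflTransGen (fun D D' => ∃ w, D' = G.chipFire w D) D₁ D₂

/-- The degree of a divisor. -/
def divisorDegree (D : V → ℤ) : ℤ := ∑ v, D v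

/-- `D` is equivalent to an effective divisor. -/
def EquivEffective (D : V → ℤ) : Prop := ∃ D', G.DivisorEquiv D D' ∧ 0 ≤ D'

open Classical in
/-- The rank of a divisor: `-1` if it is not equivalent to an effective divisor, and otherwise the
largest `r` such that `D - E` is equivalent to an effective divisor for all effective `E` of
degree `r`. -/
noncomputable def divisorRank (D : V → ℤ) : ℤ :=
  if G.EquivEffective D then
    ((sSup {r : ℕ | ∀ E : V → ℤ, 0 ≤ E → divisorDegree E = r → G.EquivEffective (D - E)} : ℕ) : ℤ)
  else -1

/-- The gonality `gon(G)`: the smallest degree of a divisor of positive rank. (Such a divisor has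
positive degree if there is a vertex.) -/
noncomputable def gonality : ℕ :=
  sInf {d : ℕ | ∃ D : V → ℤ, divisorDegree D = d ∧ 0 < G.divisorRank D}

end Invariants

end Multigraph

/-! Both cases squeeze `scrambleNumber ≤ gonality` between an upper bound for the gonality and a
lower bound for the scramble number.

Upper bound: an optimal divisor on one factor, pulled back along the projection, has positive rank
on the product (`gonality_boxProd_le_left`, `gonality_boxProd_le_right`).

Lower bound: take as eggs the copies of $G$ with fewer than $k$ vertices deleted (`rowScramble`),
connected since $k\le\kappa(G)$. A hitting set needs $k$ vertices in every copy. An egg-cut has one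
slice that is nearly all of $V(G)$ and one that is nearly empty. The vertices on which these slices
differ as expected force $\lambda(H)$ edges each in their copies of $H$; the fewer than $k$
exceptions on each side are paid for by $\lambda(G)\ge(k-1)\lambda(H)$
(`le_edgesBetween_of_isEggCut_rowScramble`).

The inequality $\mathrm{sn}\le\mathrm{gon}$ is `IsScramble.le_divisorDegree`: chips are moved
towards an egg without chips by firing level sets, and one of the fired sets is an egg-cut whose
boundary is bounded by the degree. -/

namespace Multigraph

/-! ### Divisor equivalence and rank through the Laplacian. -/

section Laplacian

variable {V : Type*} [Fintype V] (G : Multigraph V)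

/-- The Laplacian of a multigraph, acting on firing scripts `V → ℤ`. -/
def laplacian : (V → ℤ) →+ (V → ℤ) where
  toFun f v := ∑ u, (G.mult s(v, u) : ℤ) * (f v - f u)
  map_zero' := by ext; simp
  map_add' f g := by
    ext v
    simp only [Pi.add_apply, ← Finset.sum_add_distrib]
    exact Finset.sum_congr rfl fun u _ => by ring

theorem laplacian_apply (f : V → ℤ) (v : V) :
    G.laplacian f v = ∑ u, (G.mult s(v, u) : ℤ) * (f v - f u) := rfl

theorem laplacian_const (c : ℤ) : G.laplacian (fun _ => c) = 0 := by
  ext v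
  simp [laplacian_apply]

theorem divisorDegree_laplacian (f : V → ℤ) : divisorDegree (G.laplacian f) = 0 := by
  have h : divisorDegree (G.laplacian f) = -divisorDegree (G.laplacian f) := by
    simp only [divisorDegree, laplacian_apply]
    conv_lhs => rw [Finset.sum_comm]
    simp only [← Finset.sum_neg_distrib]
    refine Finset.sum_congr rfl fun u _ => Finset.sum_congr rfl fun v _ => ?_
    rw [Sym2.eq_swap]
    ring
  linarith

theorem divisorDegree_sub (D E : V → ℤ) :
    divisorDegree (D - E) = divisorDegree D - divisorDegree E := by
  simp [divisorDegree]

variable [DecidableEq V]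

theorem chipFire_eq (w : V) (D : V → ℤ) :
    G.chipFire w D = D - G.laplacian (Pi.single w 1) := by
  ext v
  simp only [chipFire, Pi.sub_apply, laplacian_apply]
  split_ifs with h
  · subst h
    simp only [valence, Pi.single_eq_same, Nat.cast_sum]
    congr 1
    refine Finset.sum_congr rfl fun u _ => ?_
    by_cases hu : u = v
    · subst hu
      simp [G.loopless]
    · simp [hu]
  · simp [h, Pi.single_apply]

theorem divisorEquiv_sub_laplacian_of_nonneg (D f : V → ℤ) (hf : 0 ≤ f) :
    G.DivisorEquiv D (D - G.laplacian f) := by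
  let M : AddSubmonoid (V → ℤ) :=
    { carrier := {g | ∀ D, G.DivisorEquiv D (D - G.laplacian g)}
      zero_mem' := fun D => by
        rw [map_zero, sub_zero]
        exact Relation.ReflTransGen.refl
      add_mem' := fun {a b} ha hb D => by
        rw [map_add, ← sub_sub]
        exact (ha D).trans (hb _) }
  suffices f ∈ M from this D
  have h : f = ∑ w, (f w).toNat • (Pi.single w 1 : V → ℤ) := by
    ext v
    simp [Finset.sum_apply, Pi.single_apply]
    exact (hf v)
  rw [h]
  refine AddSubmonoid.sum_mem _ fun w _ => AddSubmonoid.nsmul_mem _ (fun D => ?_) _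
  exact Relation.ReflTransGen.single ⟨w, (G.chipFire_eq w D).symm⟩

theorem divisorEquiv_iff (D D' : V → ℤ) :
    G.DivisorEquiv D D' ↔ ∃ f, D' = D - G.laplacian f := by
  constructor
  · intro h
    induction h with
    | refl => exact ⟨0, by simp⟩
    | tail _ h ih =>
      obtain ⟨f, rfl⟩ := ih
      obtain ⟨w, rfl⟩ := h
      exact ⟨f + Pi.single w 1, by rw [chipFire_eq, map_add, sub_sub]⟩
  · rintro ⟨f, rfl⟩
    -- Constants lie in the kernel of the Laplacian, so any script can be shifted to a nonnegative
    -- one, which is realised by actual firings.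
    have h := G.divisorEquiv_sub_laplacian_of_nonneg D (f + fun _ => ∑ u, |f u|) fun v => by
      have h₁ : |f v| ≤ ∑ u, |f u| :=
        Finset.single_le_sum (fun u _ => abs_nonneg (f u)) (Finset.mem_univ v)
      have h₂ := neg_abs_le (f v)
      simp only [Pi.zero_apply, Pi.add_apply]
      linarith
    rwa [map_add, laplacian_const, add_zero] at h

theorem equivEffective_iff (D : V → ℤ) :
    G.EquivEffective D ↔ ∃ f, 0 ≤ D - G.laplacian f := by
  constructor
  · rintro ⟨D', h, h'⟩
    obtain ⟨f, rfl⟩ := (G.divisorEquiv_iff _ _).1 h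
    exact ⟨f, h'⟩
  · rintro ⟨f, h⟩
    exact ⟨_, (G.divisorEquiv_iff _ _).2 ⟨f, rfl⟩, h⟩

theorem divisorDegree_single (v : V) (n : ℤ) : divisorDegree (Pi.single v n : V → ℤ) = n := by
  simp [divisorDegree]

variable {G} in
theorem EquivEffective.divisorDegree_nonneg {D : V → ℤ} (h : G.EquivEffective D) :
    0 ≤ divisorDegree D := by
  obtain ⟨f, hf⟩ := (G.equivEffective_iff D).1 h
  have h₁ : 0 ≤ divisorDegree (D - G.laplacian f) := Finset.sum_nonneg fun v _ => hf v
  rwa [divisorDegree_sub, divisorDegree_laplacian, sub_zero] at h₁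

variable {G} in
theorem EquivEffective.mono {D D' : V → ℤ} (h : G.EquivEffective D) (hD : D ≤ D') :
    G.EquivEffective D' := by
  obtain ⟨f, hf⟩ := (G.equivEffective_iff D).1 h
  exact (G.equivEffective_iff D').2 ⟨f, hf.trans (sub_le_sub_right hD _)⟩

theorem exists_eq_single_of_divisorDegree_eq_one {E : V → ℤ} (hE : 0 ≤ E)
    (h : divisorDegree E = 1) : ∃ v, E = Pi.single v 1 := by
  obtain ⟨v, hv⟩ : ∃ v, 0 < E v := by
    by_contra! hc
    have : divisorDegree E ≤ 0 := Finset.sum_nonpos fun v _ => hc v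
    omega
  refine ⟨v, ?_⟩
  have h₁ : ∀ u, 0 ≤ (E - Pi.single v 1 : V → ℤ) u := fun u => by
    by_cases hu : u = v
    · subst hu
      simp
      omega
    · simpa [hu] using hE u
  have h₂ : ∑ u, (E - Pi.single v 1 : V → ℤ) u = 0 := by
    have := divisorDegree_sub E (Pi.single v 1)
    rwa [h, divisorDegree_single, sub_self] at this
  have h₃ := (Finset.sum_eq_zero_iff_of_nonneg fun u _ => h₁ u).1 h₂
  ext u
  have := h₃ u (Finset.mem_univ u)
  simp only [Pi.sub_apply] at this
  omega

theorem divisorRank_pos_iff [Nonempty V] (D : V → ℤ) :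
    0 < G.divisorRank D ↔ ∀ v, G.EquivEffective (D - Pi.single v 1) := by
  classical
  set R : Set ℕ :=
    {r : ℕ | ∀ E : V → ℤ, 0 ≤ E → divisorDegree E = r → G.EquivEffective (D - E)} with hR
  have hrank : G.divisorRank D = if G.EquivEffective D then ((sSup R : ℕ) : ℤ) else -1 := by
    unfold divisorRank
    congr
  -- Boundedness matters because `sSup` of an unbounded set of naturals is 0. Multiples of a single
  -- vertex already bound `r` by the degree.
  have hbdd : BddAbove R := by
    obtain ⟨v⟩ := ‹Nonempty V›
    refine ⟨(divisorDegree D).toNat, fun r hr => ?_⟩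
    have := (hr (Pi.single v r) (by simp) (divisorDegree_single v _)).divisorDegree_nonneg
    rw [divisorDegree_sub, divisorDegree_single] at this
    omega
  rw [hrank]
  constructor
  · intro h v
    split_ifs at h with hD
    swap
    · omega
    have hpos : 0 < sSup R := by exact_mod_cast h
    have hne : R.Nonempty := by
      by_contra hc
      rw [Set.not_nonempty_iff_eq_empty.1 hc] at hpos
      simp at hpos
    have hmem := Nat.sSup_mem hne hbdd
    refine (hmem (Pi.single v (sSup R : ℕ)) (by simp) (divisorDegree_single v _)).mono ?_
    refine sub_le_sub_left (Pi.single_mono v ?_) _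
    exact_mod_cast hpos
  · intro h
    have h₁ : G.EquivEffective D := by
      obtain ⟨v⟩ := ‹Nonempty V›
      exact (h v).mono (sub_le_self _ (by simp))
    have h₂ : 1 ∈ R := fun E hE hd => by
      obtain ⟨v, rfl⟩ := exists_eq_single_of_divisorDegree_eq_one hE (by simpa using hd)
      exact h v
    rw [if_pos h₁]
    exact_mod_cast le_csSup hbdd h₂

theorem exists_divisor_gonality [Nonempty V] :
    ∃ D : V → ℤ, divisorDegree D = G.gonality ∧ ∀ v, G.EquivEffective (D - Pi.single v 1) := by
  -- One chip on every vertex has positive rank, so the infimum is attained and is not the default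
  -- value 0.
  have hne : {d : ℕ | ∃ D : V → ℤ, divisorDegree D = d ∧ 0 < G.divisorRank D}.Nonempty := by
    refine ⟨Fintype.card V, fun _ => 1, by simp [divisorDegree], ?_⟩
    refine (G.divisorRank_pos_iff _).2 fun v => (G.equivEffective_iff _).2 ⟨0, fun u => ?_⟩
    by_cases hu : u = v
    · subst hu
      simp
    · simp [hu]
  obtain ⟨D, hD, hr⟩ := Nat.sInf_mem hne
  exact ⟨D, hD, (G.divisorRank_pos_iff D).1 hr⟩

theorem gonality_le [Nonempty V] {D : V → ℤ} {d : ℕ} (hd : divisorDegree D = d)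
    (hD : ∀ v, G.EquivEffective (D - Pi.single v 1)) : G.gonality ≤ d :=
  Nat.sInf_le ⟨D, hd, (G.divisorRank_pos_iff D).2 hD⟩

end Laplacian

/-! ### Firing scripts level by level. -/

section LevelSets

variable {V : Type*} [Fintype V] (G : Multigraph V)

/-- Firing the superlevel sets of `f` from the top down keeps the divisor effective. -/
theorem sub_laplacian_max_nonneg {D f : V → ℤ} (hD : 0 ≤ D) (hf : 0 ≤ D - G.laplacian f) (t : ℤ) :
    0 ≤ D - G.laplacian (fun u => max (f u) t) := by
  intro u
  -- Below the threshold, `u` is a minimum of the truncated script and only gains chips; above it,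
  -- raising the other values only reduces what `u` loses.
  rcases le_total (f u) t with h | h
  · have h₁ : G.laplacian (fun u => max (f u) t) u ≤ 0 := by
      rw [laplacian_apply]
      refine Finset.sum_nonpos fun w _ => mul_nonpos_of_nonneg_of_nonpos (by positivity) ?_
      have := le_max_right (f w) t
      rw [max_eq_right h]
      linarith
    have h₂ := hD u
    simp only [Pi.zero_apply, Pi.sub_apply] at *
    linarith
  · have h₁ : G.laplacian (fun u => max (f u) t) u ≤ G.laplacian f u := by
      rw [laplacian_apply, laplacian_apply]
      refine Finset.sum_le_sum fun w _ => mul_le_mul_of_nonneg_left ?_ (by positivity)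
      have := le_max_left (f w) t
      rw [max_eq_left h]
      linarith
    have h₂ := hf u
    simp only [Pi.zero_apply, Pi.sub_apply] at *
    linarith

theorem laplacian_max_self_le (f : V → ℤ) (v : V) :
    G.laplacian (fun u => max (f u) (f v)) v ≤ G.laplacian f v := by
  rw [laplacian_apply, laplacian_apply]
  refine Finset.sum_le_sum fun w _ => mul_le_mul_of_nonneg_left ?_ (by positivity)
  have := le_max_left (f w) (f v)
  rw [max_self]
  linarith

/-- Up to a constant, lowering the threshold from `t + 1` to `t` adds the indicator of `{f ≥ t +
1}`, so each step fires one superlevel set. -/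
theorem laplacian_max_succ (f : V → ℤ) (t : ℤ) :
    G.laplacian (fun u => max (f u) t) = G.laplacian (fun u => max (f u) (t + 1)) +
      G.laplacian (fun u => if t + 1 ≤ f u then 1 else 0) := by
  have h : (fun u => max (f u) t) = (fun u => max (f u) (t + 1)) +
      (fun u => if t + 1 ≤ f u then (1 : ℤ) else 0) + fun _ => -1 := by
    ext u
    simp only [Pi.add_apply]
    split_ifs <;> omega
  rw [h, map_add, map_add, laplacian_const, add_zero]

variable [DecidableEq V]

theorem laplacian_indicator_of_mem {U : Finset V} {u : V} (hu : u ∈ U) :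
    G.laplacian (fun x => if x ∈ U then 1 else 0) u = ∑ w ∈ Uᶜ, (G.mult s(u, w) : ℤ) := by
  rw [laplacian_apply, ← Finset.sum_add_sum_compl U]
  rw [Finset.sum_eq_zero fun w hw => by simp [hu, hw], zero_add]
  refine Finset.sum_congr rfl fun w hw => ?_
  simp [hu, Finset.mem_compl.1 hw]

theorem laplacian_indicator_of_notMem {U : Finset V} {u : V} (hu : u ∉ U) :
    G.laplacian (fun x => if x ∈ U then 1 else 0) u = -∑ w ∈ U, (G.mult s(u, w) : ℤ) := by
  rw [laplacian_apply, ← Finset.sum_add_sum_compl U]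
  rw [Finset.sum_eq_zero (s := Uᶜ) fun w hw => by simp [hu, Finset.mem_compl.1 hw], add_zero,
    ← Finset.sum_neg_distrib]
  refine Finset.sum_congr rfl fun w hw => ?_
  simp [hu, hw]

end LevelSets

/-! ### Scramble number bounds gonality from below. -/

section Scrambles

variable {V : Type*} {G : Multigraph V}

theorem ConnectedSubset.nonempty {E : Finset V} (hE : G.ConnectedSubset E) : E.Nonempty := by
  obtain ⟨x⟩ := SimpleGraph.Connected.nonempty hE
  exact ⟨x.1, x.2⟩

theorem ConnectedSubset.exists_crossing {E U : Finset V} (hE : G.ConnectedSubset E) {x y : V}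
    (hx : x ∈ E) (hxU : x ∈ U) (hy : y ∈ E) (hyU : y ∉ U) :
    ∃ a ∈ E, ∃ b ∈ E, a ∈ U ∧ b ∉ U ∧ 0 < G.mult s(a, b) := by
  obtain ⟨p⟩ := hE.preconnected ⟨x, hx⟩ ⟨y, hy⟩
  obtain ⟨d, -, h₁, h₂⟩ := p.exists_boundary_dart {z | z.1 ∈ U} hxU hyU
  exact ⟨_, d.fst.2, _, d.snd.2, h₁, h₂, d.adj⟩

variable [Fintype V] [DecidableEq V]

/-- Divisors of positive rank have degree at least the order of every scramble. -/
theorem IsScramble.le_divisorDegree [Nonempty V] {S : Finset (Finset V)} (hS : G.IsScramble S)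
    {k : ℕ} (hhit : ∀ C, IsHittingSet S C → k ≤ C.card)
    (hcut : ∀ A, IsEggCut S A → k ≤ G.edgesBetween A Aᶜ) {D : V → ℤ}
    (hD : ∀ v, G.EquivEffective (D - Pi.single v 1)) : (k : ℤ) ≤ divisorDegree D := by
  let hits : (V → ℤ) → Finset (Finset V) := fun F => S.filter fun E => ∃ x ∈ E, 0 < F x
  have hmem : ∀ F E, E ∈ hits F ↔ E ∈ S ∧ ∃ x ∈ E, 0 < F x := fun F E => Finset.mem_filter
  let T : Set (Finset (Finset V)) := {X | ∃ f, 0 ≤ D - G.laplacian f ∧ X = hits (D - G.laplacian f)}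
  have hT : T.Nonempty := by
    obtain ⟨v⟩ := ‹Nonempty V›
    obtain ⟨f, hf⟩ := (G.equivEffective_iff D).1 ((hD v).mono (sub_le_self _ (by simp)))
    exact ⟨_, f, hf, rfl⟩
  -- Among the effective divisors equivalent to `D`, choose one whose set of eggs carrying chips is
  -- maximal.
  obtain ⟨X, ⟨f₀, hf₀, rfl⟩, hmax⟩ := (Set.toFinite T).exists_maximal hT
  set D₀ := D - G.laplacian f₀ with hD₀
  have hdeg : ∀ f, divisorDegree (D₀ - G.laplacian f) = divisorDegree D := fun f => by
    simp [hD₀, divisorDegree_sub, divisorDegree_laplacian]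
  by_cases hh : IsHittingSet S (Finset.univ.filter fun x => 0 < D₀ x)
  · have h₁ := hhit _ hh
    have h₂ : ((Finset.univ.filter fun x => 0 < D₀ x).card : ℤ) ≤ divisorDegree D₀ := by
      rw [Finset.card_filter, divisorDegree, Nat.cast_sum]
      refine Finset.sum_le_sum fun x _ => ?_
      have := hf₀ x
      simp only [Pi.zero_apply] at this
      split_ifs <;> push_cast <;> omega
    have h₃ := hdeg 0
    rw [map_zero, sub_zero] at h₃
    rw [← h₃]
    exact le_trans (by exact_mod_cast h₁) h₂
  · obtain ⟨E, hES, hE⟩ : ∃ E ∈ S, E ∉ hits D₀ := by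
      simp only [IsHittingSet] at hh
      push Not at hh
      obtain ⟨E, hES, hE⟩ := hh
      refine ⟨E, hES, fun hc => ?_⟩
      obtain ⟨-, x, hx, hx'⟩ := (hmem _ _).1 hc
      have : x ∈ (Finset.univ.filter fun x => 0 < D₀ x) ∩ E := by simp [hx, hx']
      rw [hE] at this
      simp at this
    obtain ⟨v, hvE⟩ := (hS E hES).nonempty
    obtain ⟨f, hf, hfv⟩ : ∃ f, 0 ≤ D₀ - G.laplacian f ∧ 0 < (D₀ - G.laplacian f) v := by
      obtain ⟨g, hg⟩ := (G.equivEffective_iff _).1 (hD v)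
      have h : D₀ - G.laplacian (g - f₀) = (D - Pi.single v 1 - G.laplacian g) + Pi.single v 1 := by
        rw [hD₀, map_sub]
        abel
      refine ⟨g - f₀, ?_, ?_⟩
      · rw [h]
        exact add_nonneg hg (by simp)
      · rw [h, Pi.add_apply, Pi.single_eq_same]
        have := hg v
        simp only [Pi.zero_apply] at this
        omega
    -- As `t` falls from `M`, `F t` runs through effective divisors from `D₀` to one with a chip on
    -- `v`, reached by `t = f v`.
    let F : ℤ → V → ℤ := fun t => D₀ - G.laplacian (fun u => max (f u) t)
    have hF : ∀ t, 0 ≤ F t := fun t => G.sub_laplacian_max_nonneg hf₀ hf t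
    obtain ⟨M, hM⟩ : ∃ M, ∀ u, f u ≤ M := ⟨Finset.univ.sup' Finset.univ_nonempty f,
      fun u => Finset.le_sup' f (Finset.mem_univ u)⟩
    have hFM : F M = D₀ := by
      have : (fun u => max (f u) M) = fun _ => M := by
        ext u
        exact max_eq_right (hM u)
      simp only [F, this, laplacian_const, sub_zero]
    have hFv : 0 < F (f v) v := by
      have := G.laplacian_max_self_le f v
      simp only [F, Pi.sub_apply] at hfv ⊢
      linarith
    have hEx : ∃ j : ℕ, E ∈ hits (F (M - j)) := by
      refine ⟨(M - f v).toNat, ?_⟩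
      have : M - ((M - f v).toNat : ℤ) = f v := by
        have := hM v
        omega
      rw [this]
      exact (hmem _ _).2 ⟨hES, v, hvE, hFv⟩
    classical
    have hj := Nat.find_spec hEx
    have hjmin : ∀ i < Nat.find hEx, E ∉ hits (F (M - i)) := fun i hi => Nat.find_min hEx hi
    have hjle : (Nat.find hEx : ℤ) ≤ M - f v := by
      have h₁ : Nat.find hEx ≤ (M - f v).toNat := by
        refine Nat.find_min' hEx ?_
        have : M - ((M - f v).toNat : ℤ) = f v := by
          have := hM v
          omega
        rw [this]
        exact (hmem _ _).2 ⟨hES, v, hvE, hFv⟩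
      have := hM v
      omega
    generalize Nat.find hEx = j at hj hjmin hjle
    -- When `E` first gains a chip, maximality forces another egg to have lost all of its chips. The
    -- step at which `E'` first does so fires the required egg-cut.
    obtain ⟨E', hE', hE'j⟩ : ∃ E' ∈ hits D₀, E' ∉ hits (F (M - j)) := by
      by_contra! hc
      refine hE (hmax (y := hits (F (M - j))) ⟨f₀ + fun u => max (f u) (M - j), ?_, ?_⟩ hc hj)
      · rw [map_add, ← sub_sub]
        exact hF _
      · rw [map_add, ← sub_sub]
    have hEx' : ∃ i : ℕ, E' ∉ hits (F (M - i)) := ⟨j, hE'j⟩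
    have hi := Nat.find_spec hEx'
    have himin : ∀ i < Nat.find hEx', E' ∈ hits (F (M - i)) := fun i hi =>
      not_not.1 (Nat.find_min hEx' hi)
    have hij : Nat.find hEx' ≤ j := Nat.find_min' hEx' hE'j
    generalize Nat.find hEx' = i at hi himin hij
    obtain _ | i := i
    · simp only [Nat.cast_zero, sub_zero, hFM] at hi
      exact absurd hE' hi
    have hbefore := himin i (Nat.lt_succ_self i)
    have hEi := hjmin i (by omega)
    obtain ⟨t, ht⟩ : ∃ t : ℤ, t = M - ((i + 1 : ℕ) : ℤ) := ⟨_, rfl⟩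
    have ht' : M - (i : ℤ) = t + 1 := by
      push_cast at ht
      omega
    rw [← ht] at hi
    rw [ht'] at hbefore hEi
    have htv : f v ≤ t := by omega
    let U : Finset V := Finset.univ.filter fun u => t + 1 ≤ f u
    have hstep : F t = F (t + 1) - G.laplacian (fun x => if x ∈ U then 1 else 0) := by
      simp only [F, G.laplacian_max_succ f t, U, Finset.mem_filter, Finset.mem_univ, true_and,
        sub_sub]
    have hin : ∀ u ∈ U, F t u = F (t + 1) u - ∑ w ∈ Uᶜ, (G.mult s(u, w) : ℤ) := fun u hu => by
      rw [hstep, Pi.sub_apply, laplacian_indicator_of_mem _ hu]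
    have hout : ∀ u ∉ U, F t u = F (t + 1) u + ∑ w ∈ U, (G.mult s(u, w) : ℤ) := fun u hu => by
      rw [hstep, Pi.sub_apply, laplacian_indicator_of_notMem _ hu, sub_neg_eq_add]
    have hvU : v ∉ U := by
      simp only [U, Finset.mem_filter, Finset.mem_univ, true_and]
      omega
    have hegg : IsEggCut S U := by
      obtain ⟨hE'S, x, hxE', hx⟩ := (hmem _ _).1 hbefore
      refine ⟨E', hE'S, E, hES, ?_, ?_⟩
      -- Firing `U` empties `E'`: its chips were in `U`, and an edge of `E'` leaving `U` would have
      -- put a new chip on `E'`.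
      · have hxU : x ∈ U := by
          by_contra hxU
          refine hi ((hmem _ _).2 ⟨hE'S, x, hxE', ?_⟩)
          rw [hout x hxU]
          positivity
        by_contra hsub
        obtain ⟨y, hyE', hyU⟩ := Finset.not_subset.1 hsub
        obtain ⟨a, -, b, hb, haU, hbU, hab⟩ := (hS E' hE'S).exists_crossing hxE' hxU hyE' hyU
        refine hi ((hmem _ _).2 ⟨hE'S, b, hb, ?_⟩)
        rw [hout b hbU]
        have h₁ : (G.mult s(b, a) : ℤ) ≤ ∑ w ∈ U, (G.mult s(b, w) : ℤ) :=
          Finset.single_le_sum (f := fun w => (G.mult s(b, w) : ℤ)) (fun w _ => by positivity) haU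
        have h₂ := hF (t + 1) b
        rw [Sym2.eq_swap] at hab
        simp only [Pi.zero_apply] at h₂
        omega
      · intro y hyE
        -- If `E` met `U`, an edge of `E` would leave `U`; its end in `U` pays a chip and stays
        -- nonnegative, so `E` had a chip before the firing.
        rw [Finset.mem_compl]
        intro hyU
        obtain ⟨a, ha, b, -, haU, hbU, hab⟩ := (hS E hES).exists_crossing hyE hyU hvE hvU
        refine hEi ((hmem _ _).2 ⟨hES, a, ha, ?_⟩)
        have h₁ : (G.mult s(a, b) : ℤ) ≤ ∑ w ∈ Uᶜ, (G.mult s(a, w) : ℤ) :=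
          Finset.single_le_sum (f := fun w => (G.mult s(a, w) : ℤ)) (fun w _ => by positivity)
            (Finset.mem_compl.2 hbU)
        have h₂ := hF t a
        rw [hin a haU] at h₂
        simp only [Pi.zero_apply] at h₂
        omega
    -- Every vertex of `U` pays for its outgoing edges and stays nonnegative, so the boundary of `U`
    -- is at most the number of chips.
    have h₁ : (G.edgesBetween U Uᶜ : ℤ) ≤ divisorDegree (F (t + 1)) := by
      rw [edgesBetween, Nat.cast_sum, divisorDegree]
      refine le_trans (Finset.sum_le_sum fun u hu => ?_)
        (Finset.sum_le_sum_of_subset_of_nonneg (Finset.subset_univ U) fun u _ _ => hF (t + 1) u)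
      have h₂ := hF t u
      rw [hin u hu] at h₂
      simp only [Pi.zero_apply] at h₂
      push_cast
      omega
    rw [← hdeg (fun u => max (f u) (t + 1))]
    exact le_trans (by exact_mod_cast hcut U hegg) h₁

/-- Bounds the suprema defining `scrambleOrder` and `scrambleNumber` by the number of vertices. -/
theorem isHittingSet_univ {S : Finset (Finset V)} (hS : G.IsScramble S) :
    IsHittingSet S Finset.univ := fun E hE => by
  simpa using (hS E hE).nonempty

theorem IsScramble.le_scrambleOrder {S : Finset (Finset V)} (hS : G.IsScramble S)
    {k : ℕ} (hhit : ∀ C, IsHittingSet S C → k ≤ C.card)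
    (hcut : ∀ A, IsEggCut S A → k ≤ G.edgesBetween A Aᶜ) : k ≤ G.scrambleOrder S :=
  le_csSup ⟨Fintype.card V, fun _ hm => hm.1 _ (isHittingSet_univ hS)⟩ ⟨hhit, hcut⟩

theorem IsScramble.scrambleOrder_le_card {S : Finset (Finset V)} (hS : G.IsScramble S) :
    G.scrambleOrder S ≤ Fintype.card V :=
  csSup_le' fun _ hm => hm.1 _ (isHittingSet_univ hS)

theorem IsScramble.scrambleOrder_le_scrambleNumber {S : Finset (Finset V)}
    (hS : G.IsScramble S) : G.scrambleOrder S ≤ G.scrambleNumber :=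
  le_csSup ⟨Fintype.card V, fun _ ⟨_, hT, h⟩ => h ▸ hT.scrambleOrder_le_card⟩ ⟨S, hS, rfl⟩

/-- The scramble number is a lower bound for the gonality. -/
theorem scrambleNumber_le_gonality [Nonempty V] : G.scrambleNumber ≤ G.gonality := by
  obtain ⟨D, hdeg, hD⟩ := G.exists_divisor_gonality
  refine csSup_le' ?_
  rintro _ ⟨S, hS, rfl⟩
  refine csSup_le' fun k hk => ?_
  have := hS.le_divisorDegree hk.1 hk.2 hD
  rw [hdeg] at this
  exact_mod_cast this

end Scrambles

/-! ### Cuts and connectivity. -/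

section Connectivity

variable {V : Type*} [Fintype V] [DecidableEq V] (G : Multigraph V)

theorem edgeConnectivity_le_edgesBetween {A : Finset V} (hA : A.Nonempty) (hA' : Aᶜ.Nonempty) :
    G.edgeConnectivity ≤ G.edgesBetween A Aᶜ := by
  classical
  let I : Finset (Sym2 V) := (A ×ˢ Aᶜ).image fun p => s(p.1, p.2)
  let D : Sym2 V → ℕ := fun e => if e ∈ I then G.mult e else 0
  have hsum : ∑ e, D e = G.edgesBetween A Aᶜ := by
    simp only [D, Finset.sum_ite_mem, Finset.univ_inter, I]
    rw [Finset.sum_image, Finset.sum_product, edgesBetween]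
    -- An unordered crossing pair has only one orientation from `A` to `Aᶜ`, so no edge is counted
    -- twice.
    rintro ⟨a, b⟩ h ⟨a', b'⟩ h' heq
    simp only [Finset.coe_product, Set.mem_prod, Finset.mem_coe, Finset.mem_compl] at h h'
    rcases Sym2.eq_iff.1 heq with ⟨h₁, h₂⟩ | ⟨h₁, h₂⟩
    · exact Prod.ext h₁ h₂
    · simp only at h₁
      exact absurd (h₁ ▸ h.1) h'.2
  rw [← hsum]
  refine Nat.sInf_le ⟨D, ⟨fun e => ?_, Or.inl fun hc => ?_⟩, rfl⟩
  · simp only [D]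
    split_ifs
    · exact le_rfl
    · exact Nat.zero_le _
  · obtain ⟨a, ha⟩ := hA
    obtain ⟨b, hb⟩ := hA'
    obtain ⟨p⟩ := hc a b
    obtain ⟨d, -, h₁, h₂⟩ := p.exists_boundary_dart (A : Set V) ha
      (by simpa using Finset.mem_compl.1 hb)
    have hadj : 0 < G.mult s(d.fst, d.snd) - D s(d.fst, d.snd) := d.adj
    have hI : s(d.fst, d.snd) ∈ I := Finset.mem_image.2
      ⟨(d.fst, d.snd), Finset.mem_product.2 ⟨h₁, Finset.mem_compl.2 h₂⟩, rfl⟩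
    simp [D, hI] at hadj

/-- Removing all vertices but one is a vertex cut by the single-vertex convention. -/
theorem vertexConnectivity_lt_card [Nonempty V] : G.vertexConnectivity < Fintype.card V := by
  obtain ⟨v⟩ := ‹Nonempty V›
  have h : G.vertexConnectivity ≤ ({v}ᶜ : Finset V).card :=
    Nat.sInf_le ⟨_, ⟨fun h => by simp [Finset.ext_iff] at h, Or.inr (by simp)⟩, rfl⟩
  rw [Finset.card_compl, Finset.card_singleton] at h
  have : 0 < Fintype.card V := Fintype.card_pos_iff.2 ⟨v⟩
  omega

/-- Deleting fewer than `κ(G)` vertices leaves a connected graph. -/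
theorem connectedSubset_compl [Nonempty V] {C : Finset V} (hC : C.card < G.vertexConnectivity) :
    G.ConnectedSubset Cᶜ := by
  have hne : C ≠ Finset.univ := fun h => by
    have := G.vertexConnectivity_lt_card
    rw [h, Finset.card_univ] at hC
    omega
  have hpre : (G.toSimpleGraph.induce ((Cᶜ : Finset V) : Set V)).Preconnected := by
    by_contra hc
    exact absurd (Nat.sInf_le ⟨C, ⟨hne, Or.inl hc⟩, rfl⟩ : G.vertexConnectivity ≤ C.card)
      (not_le.2 hC)
  obtain ⟨x, hx⟩ : (Cᶜ : Finset V).Nonempty := by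
    rwa [Finset.nonempty_iff_ne_empty, Ne, Finset.compl_eq_empty_iff]
  exact (SimpleGraph.connected_iff _).2 ⟨hpre, ⟨⟨x, hx⟩⟩⟩

end Connectivity

/-! ### Cartesian products: gonality bounds and the row scramble. -/

section BoxProd

variable {V W : Type*} [DecidableEq V] [DecidableEq W] (G : Multigraph V) (H : Multigraph W)

theorem boxProd_mult (p q : V × W) : (G.boxProd H).mult s(p, q) =
    (if p.1 = q.1 then H.mult s(p.2, q.2) else 0) +
      (if p.2 = q.2 then G.mult s(p.1, q.1) else 0) := rfl

variable {G} in
theorem ConnectedSubset.product_singleton {B : Finset V} (hB : G.ConnectedSubset B) (w : W) :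
    (G.boxProd H).ConnectedSubset (B ×ˢ {w}) := by
  let φ : G.toSimpleGraph.induce (B : Set V) →g
      (G.boxProd H).toSimpleGraph.induce ((B ×ˢ {w} : Finset (V × W)) : Set (V × W)) :=
    { toFun := fun x => ⟨(x.1, w), by simp⟩
      map_rel' := fun {x y} h => by
        change 0 < (G.boxProd H).mult s((x.1, w), (y.1, w))
        have h' : 0 < G.mult s(x.1, y.1) := h
        rw [boxProd_mult, if_pos rfl]
        simp only
        omega }
  refine SimpleGraph.Connected.map φ ?_ hB
  rintro ⟨⟨x, y⟩, hxy⟩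
  simp only [Finset.coe_product, Finset.coe_singleton, Set.mem_prod, Finset.mem_coe,
    Set.mem_singleton_iff] at hxy
  obtain ⟨hx, rfl⟩ := hxy
  exact ⟨⟨x, hx⟩, rfl⟩

variable [Fintype V] [Fintype W]

/-- A pulled-back script is constant along each copy of `H`, so only edges of `G` contribute. -/
theorem laplacian_boxProd_fst (f : V → ℤ) (p : V × W) :
    (G.boxProd H).laplacian (fun q => f q.1) p = G.laplacian f p.1 := by
  rw [laplacian_apply, laplacian_apply, Fintype.sum_prod_type]
  refine Finset.sum_congr rfl fun u _ => ?_
  by_cases hu : p.1 = u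
  · simp [hu]
  · simp [boxProd_mult, hu]

theorem laplacian_boxProd_snd (f : W → ℤ) (p : V × W) :
    (G.boxProd H).laplacian (fun q => f q.2) p = H.laplacian f p.2 := by
  rw [laplacian_apply, laplacian_apply, Fintype.sum_prod_type_right]
  refine Finset.sum_congr rfl fun u _ => ?_
  by_cases hu : p.2 = u
  · simp [hu]
  · simp [boxProd_mult, hu]

/-- Running the same script in all copies of `G` at once brings a chip to any prescribed vertex; the
pullback has one copy of the divisor for each vertex of `H`. -/
theorem gonality_boxProd_le_left [Nonempty V] [Nonempty W] :
    (G.boxProd H).gonality ≤ G.gonality * Fintype.card W := by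
  obtain ⟨D, hdeg, hD⟩ := G.exists_divisor_gonality
  refine (G.boxProd H).gonality_le (D := fun p => D p.1) ?_ fun p => ?_
  · rw [divisorDegree] at hdeg ⊢
    rw [Fintype.sum_prod_type_right]
    simp [hdeg, mul_comm]
  · obtain ⟨f, hf⟩ := (G.equivEffective_iff _).1 (hD p.1)
    refine ((G.boxProd H).equivEffective_iff _).2 ⟨fun q => f q.1, fun q => ?_⟩
    have h := hf q.1
    simp only [Pi.zero_apply, Pi.sub_apply, laplacian_boxProd_fst, Pi.single_apply] at h ⊢
    by_cases hq : q = p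
    · subst hq
      simpa using h
    · rw [if_neg hq]
      split_ifs at h <;> omega

theorem gonality_boxProd_le_right [Nonempty V] [Nonempty W] :
    (G.boxProd H).gonality ≤ Fintype.card V * H.gonality := by
  obtain ⟨D, hdeg, hD⟩ := H.exists_divisor_gonality
  refine (G.boxProd H).gonality_le (D := fun p => D p.2) ?_ fun p => ?_
  · rw [divisorDegree] at hdeg ⊢
    simp [Fintype.sum_prod_type, hdeg]
  · obtain ⟨f, hf⟩ := (H.equivEffective_iff _).1 (hD p.2)
    refine ((G.boxProd H).equivEffective_iff _).2 ⟨fun q => f q.2, fun q => ?_⟩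
    have h := hf q.2
    simp only [Pi.zero_apply, Pi.sub_apply, laplacian_boxProd_snd, Pi.single_apply] at h ⊢
    by_cases hq : q = p
    · subst hq
      simpa using h
    · rw [if_neg hq]
      split_ifs at h <;> omega

/-- The slice of a set of vertices of a product in the copy of the first factor over `w`. -/
def rowSlice (A : Finset (V × W)) (w : W) : Finset V := {v | (v, w) ∈ A}

/-- The slice of a set of vertices of a product in the copy of the second factor over `v`. -/
def colSlice (A : Finset (V × W)) (v : V) : Finset W := {w | (v, w) ∈ A}

omit [Fintype W] in
theorem mem_rowSlice {A : Finset (V × W)} {v : V} {w : W} : v ∈ rowSlice A w ↔ (v, w) ∈ A := by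
  simp [rowSlice]

omit [Fintype V] in
theorem mem_colSlice {A : Finset (V × W)} {v : V} {w : W} : w ∈ colSlice A v ↔ (v, w) ∈ A := by
  simp [colSlice]

theorem edgesBetween_compl_eq (A : Finset V) : G.edgesBetween A Aᶜ =
    ∑ a, ∑ b, if a ∈ A ∧ b ∉ A then G.mult s(a, b) else 0 := by
  rw [edgesBetween, ← Finset.sum_filter_add_sum_filter_not Finset.univ (· ∈ A)]
  rw [Finset.sum_eq_zero (s := Finset.univ.filter (· ∉ A)), add_zero, Finset.filter_univ_mem]
  · refine Finset.sum_congr rfl fun a ha => ?_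
    rw [← Finset.sum_filter]
    exact Finset.sum_congr (by ext; simp [ha]) fun _ _ => rfl
  · intro a ha
    simp only [Finset.mem_filter] at ha
    simp [ha.2]

/-- Each edge of the product lies in exactly one copy of a factor. -/
theorem edgesBetween_boxProd (A : Finset (V × W)) : (G.boxProd H).edgesBetween A Aᶜ =
    ∑ w, G.edgesBetween (rowSlice A w) (rowSlice A w)ᶜ +
      ∑ v, H.edgesBetween (colSlice A v) (colSlice A v)ᶜ := by
  simp only [edgesBetween_compl_eq, mem_rowSlice, mem_colSlice]
  have h₁ : ∀ p q : V × W, (if p ∈ A ∧ q ∉ A then (G.boxProd H).mult s(p, q) else 0) =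
      (if p.2 = q.2 then if p ∈ A ∧ q ∉ A then G.mult s(p.1, q.1) else 0 else 0) +
      (if p.1 = q.1 then if p ∈ A ∧ q ∉ A then H.mult s(p.2, q.2) else 0 else 0) := by
    intro p q
    rw [boxProd_mult]
    split_ifs <;> omega
  simp only [h₁, Finset.sum_add_distrib]
  congr 1
  · simp only [Fintype.sum_prod_type]
    rw [Finset.sum_comm]
    simp
  · simp only [Fintype.sum_prod_type]
    refine Finset.sum_congr rfl fun v _ => Finset.sum_congr rfl fun w _ => ?_
    rw [Finset.sum_comm]
    simp

variable [Nonempty V]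

/-- The scramble on a product whose eggs are the copies of the first factor with fewer than `k`
vertices removed. -/
def rowScramble (V W : Type*) [DecidableEq V] [DecidableEq W] [Fintype V] [Fintype W] (k : ℕ) :
    Finset (Finset (V × W)) :=
  Finset.univ.filter fun E => ∃ C : Finset V, C.card < k ∧ ∃ w : W, E = Cᶜ ×ˢ {w}

omit [Nonempty V] in
theorem mem_rowScramble {k : ℕ} {E : Finset (V × W)} :
    E ∈ rowScramble V W k ↔ ∃ C : Finset V, C.card < k ∧ ∃ w : W, E = Cᶜ ×ˢ {w} := by
  simp [rowScramble]

theorem isScramble_rowScramble {k : ℕ} (hκ : k ≤ G.vertexConnectivity) :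
    (G.boxProd H).IsScramble (rowScramble V W k) := by
  intro E hE
  obtain ⟨C, hC, w, rfl⟩ := mem_rowScramble.1 hE
  exact (G.connectedSubset_compl (hC.trans_le hκ)).product_singleton H w

omit [Nonempty V] in
-- If a slice of `C` had fewer than `k` vertices, deleting it from its copy of `G` would leave an
-- egg that `C` misses.
theorem le_card_of_isHittingSet_rowScramble {k : ℕ} {C : Finset (V × W)}
    (hC : IsHittingSet (rowScramble V W k) C) : k * Fintype.card W ≤ C.card := by
  have hrow : ∀ w, k ≤ (rowSlice C w).card := fun w => by
    by_contra! hlt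
    obtain ⟨⟨x, y⟩, hx⟩ := hC _ (mem_rowScramble.2 ⟨rowSlice C w, hlt, w, rfl⟩)
    simp only [Finset.mem_inter, Finset.mem_product, Finset.mem_compl, Finset.mem_singleton,
      mem_rowSlice] at hx
    obtain ⟨h₁, h₂, rfl⟩ := hx
    exact h₂ h₁
  have hcard : C.card = ∑ w, (rowSlice C w).card := by
    rw [Finset.card_eq_sum_card_fiberwise (f := Prod.snd) (t := Finset.univ) (by simp)]
    refine Finset.sum_congr rfl fun w _ => ?_
    rw [← Finset.card_map (s := rowSlice C w) ⟨fun v => (v, w), Prod.mk_left_injective w⟩]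
    refine congrArg Finset.card ?_
    ext ⟨x, y⟩
    simp only [Finset.mem_filter, Finset.mem_map, mem_rowSlice, Function.Embedding.coeFn_mk,
      Prod.mk.injEq]
    constructor
    · rintro ⟨h, rfl⟩
      exact ⟨x, h, rfl, rfl⟩
    · rintro ⟨x, h, rfl, rfl⟩
      exact ⟨h, rfl⟩
  rw [hcard, mul_comm]
  simpa using Finset.card_nsmul_le_sum Finset.univ (fun w => (rowSlice C w).card) k
    fun w _ => hrow w

theorem le_edgesBetween_of_isEggCut_rowScramble {k : ℕ} (hκ : k ≤ G.vertexConnectivity)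
    (hV : 2 * (k : ℤ) - 1 ≤ Fintype.card V)
    (hl : ((k : ℤ) - 1) * H.edgeConnectivity ≤ G.edgeConnectivity) {A : Finset (V × W)}
    (hA : IsEggCut (rowScramble V W k) A) :
    Fintype.card V * H.edgeConnectivity ≤ (G.boxProd H).edgesBetween A Aᶜ := by
  obtain ⟨E₁, hE₁, E₂, hE₂, h₁, h₂⟩ := hA
  obtain ⟨C₁, hC₁, w₁, rfl⟩ := mem_rowScramble.1 hE₁
  obtain ⟨C₂, hC₂, w₂, rfl⟩ := mem_rowScramble.1 hE₂
  have hs₁ : (rowSlice A w₁)ᶜ ⊆ C₁ := fun v hv => by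
    by_contra hc
    rw [Finset.mem_compl, mem_rowSlice] at hv
    exact hv (h₁ (by simp [hc]))
  have hs₂ : rowSlice A w₂ ⊆ C₂ := fun v hv => by
    by_contra hc
    rw [mem_rowSlice] at hv
    exact Finset.mem_compl.1 (h₂ (by simp [hc])) hv
  have hκn := G.vertexConnectivity_lt_card
  -- In a single copy the two exceptional sets would cover $V(G)$ with at most $2(k-1)$ vertices,
  -- against $|V(G)|\ge 2k-1$.
  have hw : w₁ ≠ w₂ := by
    rintro rfl
    have := Finset.card_le_card hs₁
    have := Finset.card_le_card hs₂
    have := Finset.card_add_card_compl (rowSlice A w₁)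
    omega
  -- A trivial slice costs nothing on either side. Otherwise its smaller side has at most $k-1$
  -- vertices and its boundary at least $\lambda(G)\ge(k-1)\lambda(H)$ edges.
  have hbound : ∀ B : Finset V, (B.card < k ∨ Bᶜ.card < k) →
      min B.card Bᶜ.card * H.edgeConnectivity ≤ G.edgesBetween B Bᶜ := fun B hB => by
    rcases B.eq_empty_or_nonempty with rfl | hne
    · simp
    rcases Bᶜ.eq_empty_or_nonempty with he | hne'
    · simp [he]
    refine le_trans ?_ (G.edgeConnectivity_le_edgesBetween hne hne')
    have hmin : ((min B.card Bᶜ.card : ℕ) : ℤ) ≤ k - 1 := by omega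
    have := mul_le_mul_of_nonneg_right hmin (Int.natCast_nonneg H.edgeConnectivity)
    exact_mod_cast this.trans hl
  have hc₁ := Finset.card_le_card hs₁
  have hc₂ := Finset.card_le_card hs₂
  have ha₁ := Finset.card_add_card_compl (rowSlice A w₁)
  have ha₂ := Finset.card_add_card_compl (rowSlice A w₂)
  have hb₁ := hbound (rowSlice A w₁) (Or.inr (by omega))
  have hb₂ := hbound (rowSlice A w₂) (Or.inl (by omega))
  rw [min_eq_right (by omega)] at hb₁
  rw [min_eq_left (by omega)] at hb₂
  have hrows : G.edgesBetween (rowSlice A w₁) (rowSlice A w₁)ᶜ +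
      G.edgesBetween (rowSlice A w₂) (rowSlice A w₂)ᶜ ≤
      ∑ w, G.edgesBetween (rowSlice A w) (rowSlice A w)ᶜ := by
    rw [← Finset.sum_pair (f := fun w => G.edgesBetween (rowSlice A w) (rowSlice A w)ᶜ) hw]
    exact Finset.sum_le_sum_of_subset (Finset.subset_univ _)
  -- Over a vertex in the first slice but not in the second, the copy of `H` is properly divided by
  -- `A`.
  have hcols : (rowSlice A w₁ \ rowSlice A w₂).card * H.edgeConnectivity ≤
      ∑ v, H.edgesBetween (colSlice A v) (colSlice A v)ᶜ := by
    rw [← smul_eq_mul]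
    refine (Finset.card_nsmul_le_sum _ _ _ fun v hv => ?_).trans
      (Finset.sum_le_sum_of_subset (Finset.subset_univ _))
    rw [Finset.mem_sdiff, mem_rowSlice, mem_rowSlice] at hv
    exact H.edgeConnectivity_le_edgesBetween ⟨w₁, mem_colSlice.2 hv.1⟩
      ⟨w₂, by rw [Finset.mem_compl, mem_colSlice]; exact hv.2⟩
  have hcount : Fintype.card V ≤ (rowSlice A w₁ \ rowSlice A w₂).card +
      (rowSlice A w₁)ᶜ.card + (rowSlice A w₂).card := by
    have := Finset.le_card_sdiff (rowSlice A w₂) (rowSlice A w₁)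
    omega
  rw [edgesBetween_boxProd]
  have := Nat.mul_le_mul_right H.edgeConnectivity hcount
  rw [add_mul, add_mul] at this
  omega

/-- The scramble number of a product is at least the order of its row scramble. -/
theorem min_le_scrambleNumber_boxProd {k : ℕ} (hκ : k ≤ G.vertexConnectivity)
    (hV : 2 * (k : ℤ) - 1 ≤ Fintype.card V)
    (hl : ((k : ℤ) - 1) * H.edgeConnectivity ≤ G.edgeConnectivity) :
    min (k * Fintype.card W) (Fintype.card V * H.edgeConnectivity) ≤
      (G.boxProd H).scrambleNumber := by
  have hS := isScramble_rowScramble G H hκ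
  refine le_trans (hS.le_scrambleOrder (fun C hC => ?_) fun A hA => ?_)
    hS.scrambleOrder_le_scrambleNumber
  · exact (min_le_left _ _).trans (le_card_of_isHittingSet_rowScramble hC)
  · exact (min_le_right _ _).trans (le_edgesBetween_of_isEggCut_rowScramble G H hκ hV hl hA)

end BoxProd

end Multigraph

/-! ### The two cases of the theorem. -/

theorem mainTheorem9 {V W : Type*} [Fintype V] [DecidableEq V] [Fintype W] [DecidableEq W]
    (G : Multigraph V) (H : Multigraph W) (hG : G.Connected) (hH : H.Connected) (k : ℕ)
    (hκ : k ≤ G.vertexConnectivity)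
    (hV : 2 * (k : ℤ) - 1 ≤ (Fintype.card V : ℤ))
    (hl : ((k : ℤ) - 1) * (H.edgeConnectivity : ℤ) ≤ (G.edgeConnectivity : ℤ)) :
    (k * Fintype.card W ≤ Fintype.card V * H.edgeConnectivity → G.gonality = k →
      (G.boxProd H).scrambleNumber = (G.boxProd H).gonality ∧
        (G.boxProd H).gonality = k * Fintype.card W) ∧
    (Fintype.card V * H.edgeConnectivity ≤ k * Fintype.card W →
      H.gonality = H.edgeConnectivity →
      (G.boxProd H).scrambleNumber = (G.boxProd H).gonality ∧
        (G.boxProd H).gonality = Fintype.card V * H.edgeConnectivity) := by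
  have : Nonempty V := SimpleGraph.Connected.nonempty hG
  have : Nonempty W := SimpleGraph.Connected.nonempty hH
  have hlow := Multigraph.min_le_scrambleNumber_boxProd G H hκ hV hl
  have hsn := (G.boxProd H).scrambleNumber_le_gonality
  constructor
  · intro h hgon
    have hup := Multigraph.gonality_boxProd_le_left G H
    rw [hgon] at hup
    rw [min_eq_left h] at hlow
    exact ⟨le_antisymm hsn (hup.trans hlow), le_antisymm hup (hlow.trans hsn)⟩
  · intro h hgon
    have hup := Multigraph.gonality_boxProd_le_right G H
    rw [hgon] at hup
    rw [min_eq_right h] at hlow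
    exact ⟨le_antisymm hsn (hup.trans hlow), le_antisymm hup (hlow.trans hsn)⟩
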